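/- For a nonzero Banach space $Z$ over $\mathbb{K}\in\{\mathbb{R},\mathbb{C}\}$ and a bounded linear operator $T$ on $Z$, let $v(T)=\sup\{|z^*(Tz)| : z\in Z,\ z^*\in Z^*,\ \|z\|=\|z^*\|=1,\ z^*(z)=1\}$ be the numerical radius of $T$, and let $n(Z)=\inf\{v(T) : T \text{ a bounded linear operator on } Z,\ \|T\|=1\}$ be the numerical index of $Z$. For Banach spaces $X,Y$ over the same field, let $\mathcal{K}(X,Y)$ and $\mathcal{W}(X,Y)$ be the spaces of compact and of weakly compact operators from $X$ to $Y$, both with the operator norm. (a) There is a real Banach space $X$ with $n(X)=1$ such that $n(\mathcal{K}(X,Y))=n(\mathcal{W}(X,Y))=0$ for every nonzero real Banach space $Y$. In particular, $n(X)=1$ and $n(\mathcal{K}(X,X))=n(\mathcal{W}(X,X))=0$. (b) There is a complex Banach space $X$ with $n(X)=1$ such that $n(\mathcal{K}(X,Y))=n(\mathcal{W}(X,Y))=1/e$ for every nonzero complex Banach space $Y$. In particular, $n(X)=1$ and $n(\mathcal{K}(X,X))=n(\mathcal{W}(X,X))=1/e$. -/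

import Mathlib

universe u

section NumericalIndex

variable (𝕜 : Type*) [RCLike 𝕜]

/-- The numerical range `V(T) = {x*(Tx) : ‖x‖ = 1, ‖x*‖ = 1, x*(x) = 1}` of a bounded linear
operator `T` on a normed space `X` over `𝕜`. -/
def numericalRange {X : Type*} [NormedAddCommGroup X] [NormedSpace 𝕜 X] (T : X →L[𝕜] X) : Set 𝕜 :=
  {c | ∃ (x : X) (f : StrongDual 𝕜 X), ‖x‖ = 1 ∧ ‖f‖ = 1 ∧ f x = 1 ∧ c = f (T x)}

/-- The numerical radius `v(T) = sup {|c| : c ∈ V(T)}`. On a nonzero space the set is nonempty,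
and it is always bounded above by `‖T‖`. -/
noncomputable def numericalRadius {X : Type*} [NormedAddCommGroup X] [NormedSpace 𝕜 X]
    (T : X →L[𝕜] X) : ℝ :=
  sSup ((fun c : 𝕜 => ‖c‖) '' numericalRange 𝕜 T)

/-- The numerical index `n(X) = inf {v(T) : ‖T‖ = 1}` of a nonzero normed space `X` over `𝕜`. -/
noncomputable def numericalIndex (X : Type*) [NormedAddCommGroup X] [NormedSpace 𝕜 X] : ℝ :=
  sInf {r | ∃ T : X →L[𝕜] X, ‖T‖ = 1 ∧ r = numericalRadius 𝕜 T}

end NumericalIndex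

section WeaklyCompact

variable {𝕜 : Type*} [RCLike 𝕜] {X Y : Type*} [NormedAddCommGroup X] [NormedSpace 𝕜 X]
  [NormedAddCommGroup Y] [NormedSpace 𝕜 Y]

/-- A bounded linear operator is weakly compact if the image of the closed unit ball is relatively
compact in the weak topology of the target. -/
def IsWeaklyCompactOperator (T : X →L[𝕜] Y) : Prop :=
  IsCompact (closure ((fun x => toWeakSpace 𝕜 Y (T x)) '' Metric.closedBall (0 : X) 1))

variable (𝕜 X Y)

/-- The space `W(X, Y)` of weakly compact operators, a subspace of `X →L[𝕜] Y` with the operator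
norm. -/
def weaklyCompactOperator : Submodule 𝕜 (X →L[𝕜] Y) where
  carrier := {T | IsWeaklyCompactOperator T}
  zero_mem' := by
    have h : (fun x => toWeakSpace 𝕜 Y ((0 : X →L[𝕜] Y) x)) '' Metric.closedBall (0 : X) 1 ⊆
        {0} := by
      rintro _ ⟨x, -, rfl⟩
      simp
    exact isCompact_singleton.closure_of_subset h
  add_mem' := by
    intro S T hS hT
    refine (IsCompact.add hS hT).closure_of_subset ?_
    rintro _ ⟨x, hx, rfl⟩
    exact ⟨_, subset_closure ⟨x, hx, rfl⟩, _, subset_closure ⟨x, hx, rfl⟩, by simp⟩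
  smul_mem' := by
    intro c T hT
    refine (hT.image (continuous_const_smul c)).closure_of_subset ?_
    rintro _ ⟨x, hx, rfl⟩
    exact ⟨_, subset_closure ⟨x, hx, rfl⟩, by simp⟩

end WeaklyCompact

/-!
An operator on a space of operators that is built from the domain sees the bidual of the domain, not
only the domain itself. So a Banach space `X` of numerical index one is constructed whose bidual
contains, as a summand for the maximum norm, a space `E` of small numerical index.

Let `E` be finite-dimensional and embedded isometrically by `J` into `ℓ∞(E)`, and let `X` be the
space of convergent sequences in `ℓ∞(E)` with limit in `J E` (`LimitSpace J`). Every scalar entry of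
a sequence in `X` can be changed without affecting the others, so that an almost norming vector for
an operator on `X` can be replaced by one with a unimodular entry where the image is large. This
gives numerical index one (`IsCoordinateSystem.numericalIndex_eq_one`).

For `e` in `E`, let `U n e` be the sequence that vanishes before `n` and is `J e` from `n` on. If
`T` is a weakly compact operator on `X`, the weak limit of `T (U n e)` along an ultrafilter exists;
call it `B T e`. With `q` the limit map `X → E` and `A` an operator on `E`, the assignment
`T ↦ B T ∘ A ∘ q` acts on the compact and on the weakly compact operators. It has the norm of `A`,
as rank-one operators show. Moreover `‖x + U n e‖` is asymptotically at most `max ‖x‖ ‖q x + e‖`, so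
that adding a multiple of this action to the identity increases norms no more than adding
the same multiple of `A` does. Hence the numerical index of the space of operators is at most the
numerical radius of `A` when `‖A‖ = 1` (`IsAsymptoticLifting.numericalIndex_le`).

In the real case `A` is the rotation of the Euclidean plane by a right angle, whose numerical radius
is zero. In the complex case `A` is a nilpotent operator on `ℂ²`, for a norm in which it has
norm one and numerical radius at most `1 / e` (`GlickfeldPlane`); that no complex space has a
smaller numerical index is the Bohnenblust–Karlin inequality
(`one_div_exp_one_le_numericalRadius`).
-/

open Filter Topology Set
open scoped ENNReal

/-! ### Numerical radius and numerical index -/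

section NumericalRadius

variable {𝕜 : Type*} [RCLike 𝕜] {Z : Type*} [NormedAddCommGroup Z] [NormedSpace 𝕜 Z]

lemma norm_apply_le_of_norm_eq_one (T : Z →L[𝕜] Z) {z : Z} {f : StrongDual 𝕜 Z} (hz : ‖z‖ = 1)
    (hf : ‖f‖ = 1) : ‖f (T z)‖ ≤ ‖T‖ := by
  have h1 := f.le_opNorm (T z)
  have h2 := T.le_opNorm z
  rw [hf, one_mul] at h1
  rw [hz, mul_one] at h2
  exact h1.trans h2

lemma bddAbove_norm_numericalRange (T : Z →L[𝕜] Z) :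
    BddAbove ((fun c : 𝕜 => ‖c‖) '' numericalRange 𝕜 T) := by
  refine ⟨‖T‖, ?_⟩
  rintro _ ⟨_, ⟨z, f, hz, hf, -, rfl⟩, rfl⟩
  exact norm_apply_le_of_norm_eq_one T hz hf

lemma numericalRadius_nonneg (T : Z →L[𝕜] Z) : 0 ≤ numericalRadius 𝕜 T := by
  refine Real.sSup_nonneg ?_
  rintro _ ⟨c, -, rfl⟩
  exact norm_nonneg c

lemma numericalRadius_le_norm (T : Z →L[𝕜] Z) : numericalRadius 𝕜 T ≤ ‖T‖ := by
  refine Real.sSup_le ?_ (norm_nonneg T)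
  rintro _ ⟨_, ⟨z, f, hz, hf, -, rfl⟩, rfl⟩
  exact norm_apply_le_of_norm_eq_one T hz hf

lemma norm_apply_le_numericalRadius (T : Z →L[𝕜] Z) {z : Z} {f : StrongDual 𝕜 Z} (hz : ‖z‖ = 1)
    (hf : ‖f‖ = 1) (hfz : f z = 1) : ‖f (T z)‖ ≤ numericalRadius 𝕜 T :=
  le_csSup (bddAbove_norm_numericalRange T) ⟨_, ⟨z, f, hz, hf, hfz, rfl⟩, rfl⟩

lemma numericalIndex_nonneg : 0 ≤ numericalIndex 𝕜 Z := by
  refine Real.sInf_nonneg ?_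
  rintro _ ⟨T, -, rfl⟩
  exact numericalRadius_nonneg T

lemma numericalIndex_le {T : Z →L[𝕜] Z} (hT : ‖T‖ = 1) :
    numericalIndex 𝕜 Z ≤ numericalRadius 𝕜 T := by
  refine csInf_le ⟨0, ?_⟩ ⟨T, hT, rfl⟩
  rintro _ ⟨S, -, rfl⟩
  exact numericalRadius_nonneg S

lemma le_numericalIndex [Nontrivial Z] {r : ℝ}
    (h : ∀ T : Z →L[𝕜] Z, ‖T‖ = 1 → r ≤ numericalRadius 𝕜 T) : r ≤ numericalIndex 𝕜 Z := by
  refine le_csInf ⟨_, ContinuousLinearMap.id 𝕜 Z, ContinuousLinearMap.norm_id, rfl⟩ ?_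
  rintro _ ⟨T, hT, rfl⟩
  exact h T hT

/-- The numerical radius is controlled by the growth of `‖1 + c • T‖` at `c = 0`. -/
lemma numericalRadius_le_of_norm_add_smul_le {T : Z →L[𝕜] Z} {v C : ℝ} (hv : 0 ≤ v)
    (h : ∀ (c : 𝕜) (z : Z), ‖c‖ ≤ 1 → ‖z + c • T z‖ ≤ (1 + v * ‖c‖ + C * ‖c‖ ^ 2) * ‖z‖) :
    numericalRadius 𝕜 T ≤ v := by
  refine Real.sSup_le ?_ hv
  rintro _ ⟨_, ⟨z, f, hz, hf, hfz, rfl⟩, rfl⟩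
  -- The scalar `c` of modulus `t` is rotated so that `c * f (T z)` is nonnegative.
  have key : ∀ t : ℝ, 0 < t → t ≤ 1 → ‖f (T z)‖ ≤ v + C * t := by
    intro t ht ht1
    obtain ⟨w, hw, hwf⟩ : ∃ w : 𝕜, ‖w‖ = 1 ∧ w * f (T z) = (‖f (T z)‖ : 𝕜) := by
      obtain ⟨w, hw, hwf⟩ := RCLike.exists_norm_eq_mul_self (f (T z))
      exact ⟨w, hw, hwf.symm⟩
    have hc : ‖(t : 𝕜) * w‖ = t := by simp [hw, abs_of_pos ht]
    have h1 := h ((t : 𝕜) * w) z (by rw [hc]; exact ht1)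
    have h2 := f.le_opNorm (z + ((t : 𝕜) * w) • T z)
    have h3 : f (z + ((t : 𝕜) * w) • T z) = ((1 + t * ‖f (T z)‖ : ℝ) : 𝕜) := by
      rw [map_add, map_smul, hfz, smul_eq_mul, mul_assoc, hwf]
      push_cast
      rfl
    rw [h3, RCLike.norm_ofReal, abs_of_nonneg (by positivity), hf, one_mul] at h2
    rw [hc, hz, mul_one] at h1
    have h4 : t * ‖f (T z)‖ ≤ t * (v + C * t) := by nlinarith
    exact le_of_mul_le_mul_left h4 ht
  have hlim : Tendsto (fun t : ℝ => v + C * t) (𝓝[>] 0) (𝓝 (v + C * 0)) :=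
    ((continuous_const.add (continuous_const.mul continuous_id)).tendsto 0).mono_left
      nhdsWithin_le_nhds
  rw [mul_zero, add_zero] at hlim
  refine ge_of_tendsto hlim ?_
  filter_upwards [Ioc_mem_nhdsGT (zero_lt_one (α := ℝ))] with t ht using key t ht.1 ht.2

/-- The bound on the numerical index given by a norm-one operator `Φ` with growth condition. The
condition `hΦ'` says that `Φ` has norm at least one. -/
lemma numericalIndex_le_of_norm_add_smul_le (Φ : Z →ₗ[𝕜] Z) {v C : ℝ} (hv : 0 ≤ v)
    (hΦ : ∀ z, ‖Φ z‖ ≤ ‖z‖) (hΦ' : ∀ r, 0 ≤ r → (∀ z, ‖Φ z‖ ≤ r * ‖z‖) → 1 ≤ r)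
    (h : ∀ (c : 𝕜) (z : Z), ‖c‖ ≤ 1 → ‖z + c • Φ z‖ ≤ (1 + v * ‖c‖ + C * ‖c‖ ^ 2) * ‖z‖) :
    numericalIndex 𝕜 Z ≤ v := by
  let T : Z →L[𝕜] Z := Φ.mkContinuous 1 fun z => by simpa using hΦ z
  have hT : ‖T‖ = 1 :=
    le_antisymm (Φ.mkContinuous_norm_le zero_le_one _) (hΦ' _ (norm_nonneg T) T.le_opNorm)
  exact (numericalIndex_le hT).trans (numericalRadius_le_of_norm_add_smul_le hv h)

/-- **Lumer's estimate**: the numerical radius controls the growth of `‖1 + c • T‖`. -/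
lemma norm_one_add_smul_mul_le (T : Z →L[𝕜] Z) (c : 𝕜) (hc : ‖c‖ * numericalRadius 𝕜 T < 1) :
    ‖1 + c • T‖ * (1 - ‖c‖ * numericalRadius 𝕜 T) ≤ 1 + ‖c‖ ^ 2 * ‖T‖ ^ 2 := by
  set v := numericalRadius 𝕜 T
  have hpos : 0 < 1 - ‖c‖ * v := by linarith
  have lower : ∀ x : Z, (1 - ‖c‖ * v) * ‖x‖ ≤ ‖x - c • T x‖ := by
    intro x
    rcases eq_or_ne x 0 with rfl | hx
    · simp
    have hx' : ‖x‖ ≠ 0 := norm_ne_zero_iff.mpr hx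
    obtain ⟨f, hf, hfx⟩ := exists_dual_vector 𝕜 x hx'
    have hx0 : (‖x‖ : 𝕜) ≠ 0 := by exact_mod_cast hx'
    set u : Z := (‖x‖ : 𝕜)⁻¹ • x with hu
    have hxu : x = (‖x‖ : 𝕜) • u := by rw [hu, smul_inv_smul₀ hx0]
    have hu1 : ‖u‖ = 1 := by simp [hu, norm_smul, hx']
    have hfu : f u = 1 := by rw [hu, map_smul, hfx, smul_eq_mul, inv_mul_cancel₀ hx0]
    have h1 := norm_apply_le_numericalRadius T hu1 hf hfu
    have h2 : ‖f (T x)‖ ≤ v * ‖x‖ := by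
      rw [hxu, map_smul, map_smul, norm_smul, norm_smul, hu1, mul_one, mul_comm]
      exact mul_le_mul_of_nonneg_right h1 (norm_nonneg _)
    have h3 : ‖f (x - c • T x)‖ ≤ ‖x - c • T x‖ := by
      simpa [hf] using f.le_opNorm (x - c • T x)
    have h4 : ‖x‖ - ‖c‖ * ‖f (T x)‖ ≤ ‖f (x - c • T x)‖ := by
      rw [map_sub, map_smul, hfx]
      have := norm_sub_norm_le (‖x‖ : 𝕜) (c • f (T x))
      rwa [norm_smul, RCLike.norm_ofReal, abs_norm] at this
    have h5 := mul_le_mul_of_nonneg_left h2 (norm_nonneg c)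
    nlinarith
  rw [← le_div_iff₀ hpos]
  refine ContinuousLinearMap.opNorm_le_bound _ (by positivity) fun y => ?_
  rw [div_mul_eq_mul_div, le_div_iff₀ hpos, mul_comm ‖_‖]
  refine (lower _).trans ?_
  have h6 : (1 + c • T) y - c • T ((1 + c • T) y) = y - (c * c) • T (T y) := by
    simp only [add_apply, one_apply_eq_self, smul_apply, map_add, map_smul, smul_add, mul_smul]
    abel
  rw [h6]
  refine (norm_sub_le _ _).trans ?_
  have h7 : ‖T (T y)‖ ≤ ‖T‖ * (‖T‖ * ‖y‖) :=
    (T.le_opNorm _).trans (mul_le_mul_of_nonneg_left (T.le_opNorm y) (norm_nonneg _))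
  rw [norm_smul, norm_mul]
  have h8 := mul_le_mul_of_nonneg_left h7 (mul_nonneg (norm_nonneg c) (norm_nonneg c))
  nlinarith

/-- Coordinate functionals `δ i` which determine the norm of `Z` as a supremum, with vectors `b i`
biorthogonal to them. -/
structure IsCoordinateSystem {ι : Type*} (δ : ι → StrongDual 𝕜 Z) (b : ι → Z) : Prop where
  norm_apply_le : ∀ i x, ‖δ i x‖ ≤ ‖x‖
  norm_le : ∀ x r, 0 ≤ r → (∀ i, ‖δ i x‖ ≤ r) → ‖x‖ ≤ r
  apply_self : ∀ i, δ i (b i) = 1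
  apply_of_ne : ∀ i j, j ≠ i → δ j (b i) = 0

lemma IsCoordinateSystem.norm_add_smul_le {ι : Type*} {δ : ι → StrongDual 𝕜 Z} {b : ι → Z}
    (h : IsCoordinateSystem δ b) (i : ι) (x : Z) (s : 𝕜) :
    ‖x + s • b i‖ ≤ max ‖x‖ ‖δ i x + s‖ := by
  refine h.norm_le _ _ ((norm_nonneg x).trans (le_max_left _ _)) fun j => ?_
  rw [map_add, map_smul]
  rcases eq_or_ne j i with rfl | hij
  · rw [h.apply_self, smul_eq_mul, mul_one]
    exact le_max_right _ _
  · rw [h.apply_of_ne i j hij, smul_zero, add_zero]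
    exact (h.norm_apply_le j x).trans (le_max_left _ _)

/-- Each coordinate of a vector of the unit ball can be made unimodular without leaving the ball,
and the vector is a convex combination of two such modifications. Hence every operator has numerical
radius equal to its norm. -/
theorem IsCoordinateSystem.numericalIndex_eq_one [Nontrivial Z] {ι : Type*}
    {δ : ι → StrongDual 𝕜 Z} {b : ι → Z} (h : IsCoordinateSystem δ b) :
    numericalIndex 𝕜 Z = 1 := by
  refine le_antisymm ?_ (le_numericalIndex fun T hT => ?_)
  · refine (numericalIndex_le (ContinuousLinearMap.norm_id (𝕜 := 𝕜) (E := Z))).trans ?_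
    exact (numericalRadius_le_norm _).trans ContinuousLinearMap.norm_id.le
  -- A vector whose `i`-th coordinate is unimodular yields a point of the numerical range.
  have peak : ∀ i x, ‖x‖ ≤ 1 → ‖δ i x‖ = 1 → ‖δ i (T x)‖ ≤ numericalRadius 𝕜 T := by
    intro i x hx hix
    have hx1 : ‖x‖ = 1 := le_antisymm hx (hix ▸ h.norm_apply_le i x)
    have h0 : δ i x ≠ 0 := by
      intro h0
      simp [h0] at hix
    have hfx : ((δ i x)⁻¹ • δ i) x = 1 := by simp [h0]
    have hf : ‖(δ i x)⁻¹ • δ i‖ = 1 := by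
      refine le_antisymm ?_ ?_
      · rw [norm_smul, norm_inv, hix, inv_one, one_mul]
        exact ContinuousLinearMap.opNorm_le_bound _ zero_le_one fun y => by
          simpa using h.norm_apply_le i y
      · have := ((δ i x)⁻¹ • δ i).le_opNorm x
        rwa [hfx, hx1, mul_one, norm_one] at this
    have := norm_apply_le_numericalRadius T hx1 hf hfx
    simpa [hix] using this
  rw [← hT]
  refine T.opNorm_le_of_unit_norm (numericalRadius_nonneg T) fun x hx => ?_
  refine h.norm_le _ _ (numericalRadius_nonneg T) fun i => ?_
  set a := δ i x with ha
  have ha1 : ‖a‖ ≤ 1 := hx ▸ h.norm_apply_le i x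
  obtain ⟨w, hw, hwa⟩ : ∃ w : 𝕜, ‖w‖ = 1 ∧ a = (‖a‖ : 𝕜) * w := by
    obtain ⟨w, hw, hwa⟩ := RCLike.exists_norm_mul_eq_self a
    exact ⟨w, hw, by rw [mul_comm, hwa]⟩
  have hmove : ∀ w' : 𝕜, ‖w'‖ = 1 →
      ‖δ i (T (x + (w' - a) • b i))‖ ≤ numericalRadius 𝕜 T := by
    intro w' hw'
    refine peak i _ ((h.norm_add_smul_le i x _).trans ?_) ?_
    · rw [← ha, add_sub_cancel, hx, hw', max_self]
    · rw [map_add, map_smul, h.apply_self, smul_eq_mul, mul_one, ← ha, add_sub_cancel, hw']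
  have hp := hmove w hw
  have hm := hmove (-w) (by rwa [norm_neg])
  -- `x` is a convex combination of its two modifications with coordinates `w` and `-w`.
  set t : ℝ := (1 + ‖a‖) / 2 with ht
  have hconv : x = (t : 𝕜) • (x + (w - a) • b i) + ((1 - t : ℝ) : 𝕜) • (x + (-w - a) • b i) := by
    have h1 : (t : 𝕜) * (w - a) + ((1 - t : ℝ) : 𝕜) * (-w - a) = 0 := by
      have : (t : 𝕜) * (w - a) + ((1 - t : ℝ) : 𝕜) * (-w - a) = ((2 * t - 1 : ℝ) : 𝕜) * w - a := by
        push_cast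
        ring
      rw [this, ht, show 2 * ((1 + ‖a‖) / 2) - 1 = ‖a‖ by ring, ← hwa, sub_self]
    have h2 : (t : 𝕜) + ((1 - t : ℝ) : 𝕜) = 1 := by
      push_cast
      ring
    calc x = ((t : 𝕜) + ((1 - t : ℝ) : 𝕜)) • x
          + ((t : 𝕜) * (w - a) + ((1 - t : ℝ) : 𝕜) * (-w - a)) • b i := by
            rw [h1, h2, one_smul, zero_smul, add_zero]
      _ = _ := by module
  have ht0 : 0 ≤ t := by positivity
  have ht1 : 0 ≤ 1 - t := by rw [ht]; linarith
  have hval : δ i (T x) = (t : 𝕜) * δ i (T (x + (w - a) • b i))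
      + ((1 - t : ℝ) : 𝕜) * δ i (T (x + (-w - a) • b i)) := by
    conv_lhs => rw [hconv]
    rw [map_add, map_add, map_smul, map_smul, map_smul, map_smul, smul_eq_mul, smul_eq_mul]
  rw [hval]
  refine (norm_add_le _ _).trans ?_
  rw [norm_mul, norm_mul, RCLike.norm_ofReal, RCLike.norm_ofReal, abs_of_nonneg ht0,
    abs_of_nonneg ht1]
  nlinarith [mul_le_mul_of_nonneg_left hp ht0, mul_le_mul_of_nonneg_left hm ht1]

end NumericalRadius

/-- **The Bohnenblust–Karlin inequality**. The Cauchy estimate is applied to the polynomials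
`c ↦ (1 + (c / n) • T) ^ n` rather than to their limit `c ↦ exp (c • T)`, so that no completeness
is needed. -/
theorem one_div_exp_one_le_numericalRadius {Z : Type*} [NormedAddCommGroup Z] [NormedSpace ℂ Z]
    {T : Z →L[ℂ] Z} (hT : ‖T‖ = 1) : 1 / Real.exp 1 ≤ numericalRadius ℂ T := by
  set v := numericalRadius ℂ T with hv
  set r := Real.exp 1 with hr
  have hr0 : 0 < r := Real.exp_pos 1
  have hv0 : 0 ≤ v := numericalRadius_nonneg T
  have hn : ∀ᶠ n : ℕ in atTop, r * (1 + -(r * v) / n) ^ n ≤ Real.exp (r ^ 2 / n) := by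
    filter_upwards [eventually_gt_atTop ⌈r * v⌉₊] with n hn
    have hnr : r * v < n := Nat.lt_of_ceil_lt hn
    have hn0 : (0 : ℝ) < n := (by positivity : 0 ≤ r * v).trans_lt hnr
    set α : ℝ := 1 + -(r * v) / n with hα
    have hαpos : 0 < α := by
      rw [hα, neg_div, ← sub_eq_add_neg, sub_pos, div_lt_one hn0]
      exact hnr
    have hder : HasDerivAt (fun c : ℂ => (1 + (c / n) • T) ^ n) T 0 := by
      have h1 : HasDerivAt (fun c : ℂ => 1 + (c / n) • T) ((1 / (n : ℂ)) • T) 0 :=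
        (((hasDerivAt_id (0 : ℂ)).div_const (n : ℂ)).smul_const T).const_add 1
      have h2 := h1.fun_pow' n
      have hn0' : (n : ℂ) ≠ 0 := by exact_mod_cast hn0.ne'
      have h3 : ∑ i ∈ Finset.range n, (1 + ((0 : ℂ) / n) • T) ^ (n.pred - i) * (1 / (n : ℂ)) • T *
          (1 + ((0 : ℂ) / n) • T) ^ i = T := by
        simp [← Nat.cast_smul_eq_nsmul ℂ, smul_smul, hn0']
      exact h2.congr_deriv h3
    have hbound : ∀ c ∈ Metric.sphere (0 : ℂ) r,
        ‖(1 + (c / n) • T) ^ n‖ ≤ Real.exp (r ^ 2 / n) / α ^ n := by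
      intro c hc
      have hc' : ‖c / (n : ℂ)‖ = r / n := by
        rw [norm_div, Complex.norm_natCast, mem_sphere_zero_iff_norm.mp hc]
      have h3 := norm_one_add_smul_mul_le T (c / n) (by
        rw [hc', div_mul_eq_mul_div, div_lt_one hn0]
        exact hnr)
      rw [hc', hT] at h3
      have h4 : 1 - r / n * numericalRadius ℂ T = α := by
        rw [hα, ← hv]
        ring
      rw [h4, ← le_div_iff₀ hαpos] at h3
      have h5 : 1 + (r / n) ^ 2 * 1 ^ 2 ≤ Real.exp ((r / n) ^ 2) := by
        have := Real.add_one_le_exp ((r / n) ^ 2)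
        linarith
      calc ‖(1 + (c / n) • T) ^ n‖ ≤ ‖1 + (c / n) • T‖ ^ n :=
            norm_pow_le' _ (by exact_mod_cast hn0)
        _ ≤ (Real.exp ((r / n) ^ 2) / α) ^ n :=
            pow_le_pow_left₀ (norm_nonneg _) (h3.trans (by gcongr)) n
        _ = Real.exp (r ^ 2 / n) / α ^ n := by
            rw [div_pow, ← Real.exp_nat_mul]
            congr 2
            field_simp
    have hdiff : Differentiable ℂ (fun c : ℂ => (1 + (c / n) • T) ^ n) := by
      intro c
      have h1 : HasDerivAt (fun c : ℂ => 1 + (c / n) • T) ((1 / (n : ℂ)) • T) c :=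
        (((hasDerivAt_id c).div_const (n : ℂ)).smul_const T).const_add 1
      exact (h1.fun_pow' n).differentiableAt
    have h6 := Complex.norm_deriv_le_of_forall_mem_sphere_norm_le hr0 hdiff.diffContOnCl hbound
    rw [hder.deriv, hT, le_div_iff₀ hr0, one_mul, le_div_iff₀ (pow_pos hαpos n)] at h6
    exact h6
  have hleft : Tendsto (fun n : ℕ => r * (1 + -(r * v) / n) ^ n) atTop
      (𝓝 (r * Real.exp (-(r * v)))) :=
    (Real.tendsto_one_add_div_pow_exp (-(r * v))).const_mul r
  have hright : Tendsto (fun n : ℕ => Real.exp (r ^ 2 / n)) atTop (𝓝 1) := by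
    rw [← Real.exp_zero]
    exact (Real.continuous_exp.tendsto 0).comp (tendsto_const_div_atTop_nhds_zero_nat _)
  have hfin := le_of_tendsto_of_tendsto hleft hright hn
  rw [hr, ← Real.exp_add, Real.exp_le_one_iff, ← hr] at hfin
  rw [div_le_iff₀ hr0]
  linarith

/-! ### Weak limits of weakly compact operators along asymptotic liftings -/

section Lifting

variable {𝕜 : Type*} [RCLike 𝕜] {X E Y : Type*} [NormedAddCommGroup X] [NormedSpace 𝕜 X]
  [NormedAddCommGroup E] [NormedSpace 𝕜 E] [NormedAddCommGroup Y] [NormedSpace 𝕜 Y]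

/-- A sequence of contractive linear right inverses `U n` of a contraction `q : X → E` that is
asymptotically independent of each fixed vector `x`, except through `q x`: a weak-star cluster point
of `U n` in the bidual of `X` behaves towards `X` like the inclusion of a summand `E` for the
maximum norm. -/
structure IsAsymptoticLifting (q : X →L[𝕜] E) (U : ℕ → E →ₗ[𝕜] X) : Prop where
  norm_quotient_le : ∀ x, ‖q x‖ ≤ ‖x‖
  norm_lift_le : ∀ n e, ‖U n e‖ ≤ ‖e‖
  quotient_lift : ∀ n e, q (U n e) = e
  eventually_norm_add_le : ∀ x e ε, 0 < ε → ∀ᶠ n in atTop, ‖x + U n e‖ ≤ max ‖x‖ ‖q x + e‖ + ε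

lemma norm_le_of_tendsto_dual {α : Type*} {l : Filter α} [l.NeBot] {u : α → Y} {y : Y} {C : ℝ}
    (h : ∀ φ : StrongDual 𝕜 Y, Tendsto (fun a => φ (u a)) l (𝓝 (φ y)))
    (hC : ∀ᶠ a in l, ‖u a‖ ≤ C) : ‖y‖ ≤ C := by
  obtain ⟨φ, hφ, hφy⟩ := exists_dual_vector'' 𝕜 y
  have h1 : Tendsto (fun a => ‖φ (u a)‖) l (𝓝 ‖y‖) := by
    have := (h φ).norm
    rwa [hφy, RCLike.norm_ofReal, abs_norm] at this
  refine le_of_tendsto h1 ?_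
  filter_upwards [hC] with a ha
  refine (φ.le_opNorm _).trans ((mul_le_of_le_one_left (norm_nonneg _) hφ).trans ha)

lemma eq_of_tendsto_dual {α : Type*} {l : Filter α} [l.NeBot] {u : α → Y} {y z : Y}
    (hy : ∀ φ : StrongDual 𝕜 Y, Tendsto (fun a => φ (u a)) l (𝓝 (φ y)))
    (hz : ∀ φ : StrongDual 𝕜 Y, Tendsto (fun a => φ (u a)) l (𝓝 (φ z))) : y = z :=
  (SeparatingDual.eq_iff_forall_dual_eq (R := 𝕜)).mpr fun φ => tendsto_nhds_unique (hy φ) (hz φ)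

/-- Images of bounded sequences under a weakly compact operator converge weakly along every
ultrafilter. Weak convergence is stated through functionals. -/
lemma IsWeaklyCompactOperator.exists_tendsto_dual {T : X →L[𝕜] Y} (hT : IsWeaklyCompactOperator T)
    (l : Ultrafilter ℕ) {x : ℕ → X} {C : ℝ} (hx : ∀ n, ‖x n‖ ≤ C) :
    ∃ y : Y, ∀ φ : StrongDual 𝕜 Y, Tendsto (fun n => φ (T (x n))) l (𝓝 (φ y)) := by
  obtain ⟨D, hD, hCD⟩ : ∃ D : ℝ, 0 < D ∧ C ≤ D := ⟨max C 1, by simp, by simp⟩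
  have hD0 : (D : 𝕜) ≠ 0 := by exact_mod_cast hD.ne'
  have hmem : ∀ n, toWeakSpace 𝕜 Y (T ((D : 𝕜)⁻¹ • x n)) ∈
      closure ((fun x => toWeakSpace 𝕜 Y (T x)) '' Metric.closedBall (0 : X) 1) := by
    intro n
    refine subset_closure ⟨_, ?_, rfl⟩
    rw [mem_closedBall_zero_iff, norm_smul, norm_inv, RCLike.norm_ofReal, abs_of_pos hD,
      inv_mul_le_iff₀ hD, mul_one]
    exact (hx n).trans hCD
  obtain ⟨w, -, hw⟩ := hT.ultrafilter_le_nhds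
    (l.map fun n => toWeakSpace 𝕜 Y (T ((D : 𝕜)⁻¹ • x n)))
    (le_principal_iff.mpr (mem_map.mpr (univ_mem' hmem)))
  refine ⟨(D : 𝕜) • (toWeakSpace 𝕜 Y).symm w, fun φ => ?_⟩
  have h1 : Tendsto (fun n => toWeakSpace 𝕜 Y (T ((D : 𝕜)⁻¹ • x n))) l (𝓝 w) := hw
  have h2 : Continuous fun w : WeakSpace 𝕜 Y => φ ((toWeakSpace 𝕜 Y).symm w) :=
    WeakBilin.eval_continuous _ φ
  have h3 := ((h2.tendsto w).comp h1).const_mul (D : 𝕜)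
  rw [map_smul, smul_eq_mul]
  refine h3.congr fun n => ?_
  simp [hD0]

lemma IsAsymptoticLifting.exists_weakLimit {q : X →L[𝕜] E} {U : ℕ → E →ₗ[𝕜] X}
    (h : IsAsymptoticLifting q U) {T : X →L[𝕜] Y} (hT : IsWeaklyCompactOperator T)
    (l : Ultrafilter ℕ) :
    ∃ B : E →L[𝕜] Y, ∀ e, ∀ φ : StrongDual 𝕜 Y,
      Tendsto (fun n => φ (T (U n e))) l (𝓝 (φ (B e))) := by
  choose B hB using fun e => hT.exists_tendsto_dual l (fun n => h.norm_lift_le n e)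
  refine ⟨LinearMap.mkContinuous ⟨⟨B, fun e e' => ?_⟩, fun c e => ?_⟩ ‖T‖ fun e => ?_, hB⟩
  · refine eq_of_tendsto_dual (hB _) fun φ => ?_
    simpa only [map_add] using (hB e φ).add (hB e' φ)
  · refine eq_of_tendsto_dual (hB _) fun φ => ?_
    simpa only [map_smul, RingHom.id_apply] using (hB e φ).const_smul c
  · refine norm_le_of_tendsto_dual (hB e) (Eventually.of_forall fun n => ?_)
    exact (T.le_opNorm _).trans (mul_le_mul_of_nonneg_left (h.norm_lift_le n e) (norm_nonneg _))

/-- An operator `A` on `E` acts on the weakly compact operators `T` on `X`: the restriction of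
`T**` to the copy of `E` in the bidual of `X` is composed with `A ∘ q`. This action has the norm of
`A` and at most its numerical radius. The bound `v` on the latter is encoded in the growth of
`‖1 + c • A‖`. -/
theorem IsAsymptoticLifting.numericalIndex_le [Nontrivial Y] {q : X →L[𝕜] E}
    {U : ℕ → E →ₗ[𝕜] X} (h : IsAsymptoticLifting q U) {A : E →L[𝕜] E} (hA : ‖A‖ = 1) {v C : ℝ}
    (hv : 0 ≤ v) (hC : 0 ≤ C)
    (hAv : ∀ (c : 𝕜) (e : E), ‖c‖ ≤ 1 → ‖e + c • A e‖ ≤ (1 + v * ‖c‖ + C * ‖c‖ ^ 2) * ‖e‖)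
    {M : Submodule 𝕜 (X →L[𝕜] Y)} (hM : M ≤ weaklyCompactOperator 𝕜 X Y)
    (hfac : ∀ B : E →L[𝕜] Y, B ∘L q ∈ M) : numericalIndex 𝕜 M ≤ v := by
  set l : Ultrafilter ℕ := hyperfilter ℕ
  have hl : (l : Filter ℕ) ≤ atTop := Nat.hyperfilter_le_atTop
  choose B hB using fun T : M => h.exists_weakLimit (hM T.2) l
  have hBnorm : ∀ (T : M) e, ‖B T e‖ ≤ ‖T‖ * ‖e‖ := fun T e =>
    norm_le_of_tendsto_dual (hB T e) (Eventually.of_forall fun n =>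
      ((T : X →L[𝕜] Y).le_opNorm _).trans
        (mul_le_mul_of_nonneg_left (h.norm_lift_le n e) (norm_nonneg _)))
  let Φ : M →ₗ[𝕜] M :=
    { toFun := fun T => ⟨(B T ∘L A) ∘L q, hfac _⟩
      map_add' := fun S T => by
        ext x
        refine eq_of_tendsto_dual (hB (S + T) _) fun φ => ?_
        simpa using (hB S (A (q x)) φ).add (hB T (A (q x)) φ)
      map_smul' := fun c T => by
        ext x
        refine eq_of_tendsto_dual (hB (c • T) _) fun φ => ?_
        simpa using (hB T (A (q x)) φ).const_smul c }
  have hΦapp : ∀ (T : M) x, (Φ T : X →L[𝕜] Y) x = B T (A (q x)) := fun T x => rfl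
  have hAle : ∀ e, ‖A e‖ ≤ ‖e‖ := fun e => by simpa [hA] using A.le_opNorm e
  refine numericalIndex_le_of_norm_add_smul_le (Z := M) (C := C) Φ hv (fun T => ?_)
    (fun r hr hΦr => ?_) (fun c T hc => ?_)
  · refine ContinuousLinearMap.opNorm_le_bound _ (norm_nonneg _) fun x => ?_
    exact (hBnorm T _).trans (mul_le_mul_of_nonneg_left
      ((hAle _).trans (h.norm_quotient_le x)) (norm_nonneg _))
  · rw [← hA]
    refine A.opNorm_le_bound hr fun e => ?_
    obtain ⟨g, hg, hge⟩ := exists_dual_vector'' 𝕜 (A e)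
    obtain ⟨y, hy⟩ : ∃ y : Y, ‖y‖ = 1 := by
      obtain ⟨y, hy⟩ := exists_ne (0 : Y)
      exact ⟨_, norm_smul_inv_norm (𝕜 := 𝕜) hy⟩
    -- On rank-one operators the action is the adjoint of `A`.
    let T : M := ⟨(g.smulRight y) ∘L q, hfac _⟩
    have hTapp : ∀ x, (T : X →L[𝕜] Y) x = g (q x) • y := fun x => rfl
    have hT1 : ‖T‖ ≤ 1 := by
      refine ContinuousLinearMap.opNorm_le_bound _ zero_le_one fun x => ?_
      change ‖(T : X →L[𝕜] Y) x‖ ≤ _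
      rw [one_mul, hTapp, norm_smul, hy, mul_one]
      exact ((g.le_opNorm _).trans (mul_le_of_le_one_left (norm_nonneg _) hg)).trans
        (h.norm_quotient_le x)
    have hBT : B T (A e) = g (A e) • y := by
      refine eq_of_tendsto_dual (hB T (A e)) fun φ => ?_
      refine tendsto_const_nhds.congr fun n => ?_
      simp [hTapp, h.quotient_lift]
    calc ‖A e‖ = ‖(Φ T : X →L[𝕜] Y) (U 0 e)‖ := by
          rw [hΦapp, h.quotient_lift, hBT, norm_smul, hy, hge, RCLike.norm_ofReal, abs_norm,
            mul_one]
      _ ≤ ‖Φ T‖ * ‖U 0 e‖ := (Φ T : X →L[𝕜] Y).le_opNorm _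
      _ ≤ r * ‖e‖ := by
          refine mul_le_mul ?_ (h.norm_lift_le 0 e) (norm_nonneg _) hr
          exact (hΦr T).trans (mul_le_of_le_one_right hr hT1)
  · set K := 1 + v * ‖c‖ + C * ‖c‖ ^ 2 with hK
    have hK1 : 1 ≤ K := by
      rw [hK, add_assoc]
      exact le_add_of_nonneg_right (by positivity)
    refine ContinuousLinearMap.opNorm_le_bound _ (by positivity) fun x => ?_
    have hlim : ∀ φ : StrongDual 𝕜 Y, Tendsto
        (fun n => φ ((T : X →L[𝕜] Y) (x + U n (c • A (q x))))) l
        (𝓝 (φ (((T + c • Φ T : M) : X →L[𝕜] Y) x))) := fun φ => by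
      have := ((hB T (A (q x)) φ).const_smul c).const_add (φ ((T : X →L[𝕜] Y) x))
      simpa [hΦapp] using this
    have hmax : max ‖x‖ ‖q x + c • A (q x)‖ ≤ K * ‖x‖ := by
      refine max_le (le_mul_of_one_le_left (norm_nonneg _) hK1) ((hAv c (q x) hc).trans ?_)
      exact mul_le_mul_of_nonneg_left (h.norm_quotient_le x) (by positivity)
    refine le_of_forall_pos_le_add fun ε hε => ?_
    have hε' : 0 < ε / (‖T‖ + 1) := by positivity
    refine norm_le_of_tendsto_dual hlim (hl ?_)
    filter_upwards [h.eventually_norm_add_le x (c • A (q x)) _ hε'] with n hn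
    calc ‖(T : X →L[𝕜] Y) (x + U n (c • A (q x)))‖ ≤ ‖T‖ * ‖x + U n (c • A (q x))‖ :=
          (T : X →L[𝕜] Y).le_opNorm _
      _ ≤ ‖T‖ * (K * ‖x‖ + ε / (‖T‖ + 1)) := by gcongr; exact hn.trans (by gcongr)
      _ = K * ‖T‖ * ‖x‖ + ‖T‖ / (‖T‖ + 1) * ε := by ring
      _ ≤ K * ‖T‖ * ‖x‖ + ε := by
          gcongr
          refine mul_le_of_le_one_left hε.le ((div_le_one (by positivity)).mpr (by linarith))

lemma compactOperator_le_weaklyCompactOperator :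
    compactOperator (RingHom.id 𝕜) X Y ≤ weaklyCompactOperator 𝕜 X Y := by
  intro T hT
  have h1 : IsCompact (closure (T '' Metric.closedBall (0 : X) 1)) :=
    IsCompactOperator.isCompact_closure_image_closedBall (f := (T : X →ₗ[𝕜] Y)) hT 1
  refine (h1.image (toWeakSpaceCLM 𝕜 Y).continuous).closure_of_subset ?_
  rintro _ ⟨x, hx, rfl⟩
  exact ⟨T x, subset_closure ⟨x, hx, rfl⟩, rfl⟩

lemma comp_mem_compactOperator [FiniteDimensional 𝕜 E] (B : E →L[𝕜] Y) (q : X →L[𝕜] E) :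
    B ∘L q ∈ compactOperator (RingHom.id 𝕜) X Y := by
  have : ProperSpace E := FiniteDimensional.proper_rclike 𝕜 E
  exact (isCompactOperator_of_locallyCompactSpace_dom q).clm_comp B

end Lifting

lemma nontrivial_of_contains_compactOperator {𝕜 : Type*} [RCLike 𝕜] {X Y : Type*}
    [NormedAddCommGroup X] [NormedSpace 𝕜 X] [Nontrivial X] [NormedAddCommGroup Y]
    [NormedSpace 𝕜 Y] [Nontrivial Y] {M : Submodule 𝕜 (X →L[𝕜] Y)}
    (hM : compactOperator (RingHom.id 𝕜) X Y ≤ M) : Nontrivial M := by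
  obtain ⟨x, hx⟩ := exists_ne (0 : X)
  obtain ⟨y, hy⟩ := exists_ne (0 : Y)
  obtain ⟨f, -, hfx⟩ := exists_dual_vector 𝕜 x (norm_ne_zero_iff.mpr hx)
  have hmem := hM (comp_mem_compactOperator ((ContinuousLinearMap.id 𝕜 𝕜).smulRight y) f)
  refine ⟨⟨⟨_, hmem⟩, 0, fun h0 => ?_⟩⟩
  have h1 : f x • y = 0 := congrArg (fun T : M => (T : X →L[𝕜] Y) x) h0
  simp [hfx, hx, hy] at h1

/-! ### The space of bounded scalar families -/

/-- The embedding evaluates a norming functional for each vector of `E`. -/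
lemma exists_linearIsometry_lp_infty (𝕜 : Type*) [RCLike 𝕜] (E : Type*) [NormedAddCommGroup E]
    [NormedSpace 𝕜 E] : Nonempty (E →ₗᵢ[𝕜] lp (fun _ : E => 𝕜) ∞) := by
  choose g hg hgu using fun u : E => exists_dual_vector'' 𝕜 u
  have hle : ∀ e u, ‖g u e‖ ≤ ‖e‖ := fun e u =>
    ((g u).le_opNorm e).trans (mul_le_of_le_one_left (norm_nonneg e) (hg u))
  have hmem : ∀ e, Memℓp (fun u => g u e) ∞ := fun e =>
    memℓp_infty ⟨‖e‖, by rintro _ ⟨u, rfl⟩; exact hle e u⟩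
  let L : E →ₗ[𝕜] lp (fun _ : E => 𝕜) ∞ :=
    { toFun := fun e => ⟨fun u => g u e, hmem e⟩
      map_add' := fun e e' => by ext u; exact map_add (g u) e e'
      map_smul' := fun c e => by ext u; exact map_smul (g u) c e }
  have hL : ∀ e u, L e u = g u e := fun e u => rfl
  refine ⟨⟨L, fun e => le_antisymm ?_ ?_⟩⟩
  · exact lp.norm_le_of_forall_le (norm_nonneg e) (hle e)
  · have := lp.norm_apply_le_norm ENNReal.top_ne_zero (L e) e
    rwa [hL, hgu, RCLike.norm_ofReal, abs_norm] at this

lemma isCoordinateSystem_lp_infty (𝕜 : Type*) [RCLike 𝕜] (Γ : Type*) [DecidableEq Γ] :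
    IsCoordinateSystem (𝕜 := 𝕜) (fun γ => lp.evalCLM 𝕜 (fun _ : Γ => 𝕜) ∞ γ)
      (fun γ => lp.single ∞ γ (1 : 𝕜)) where
  norm_apply_le γ x := lp.norm_apply_le_norm ENNReal.top_ne_zero x γ
  norm_le _ _ hr h := lp.norm_le_of_forall_le hr h
  apply_self γ := lp.single_apply_self (E := fun _ : Γ => 𝕜) ∞ γ 1
  apply_of_ne γ _ h := lp.single_apply_ne (E := fun _ : Γ => 𝕜) ∞ γ 1 h

/-! ### The space of convergent sequences with limit in a prescribed subspace -/

section LimitSpace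

variable {𝕜 : Type*} [RCLike 𝕜] {Z E : Type*} [NormedAddCommGroup Z] [NormedSpace 𝕜 Z]
  [NormedAddCommGroup E] [NormedSpace 𝕜 E]

/-- The pairs of a convergent sequence in `Z` and an element of `E` that is mapped to its limit by
`J`. A convergent sequence is encoded as a continuous function on the one-point compactification
of `ℕ`. -/
def limitSubmodule (J : E →ₗᵢ[𝕜] Z) : Submodule 𝕜 (C(OnePoint ℕ, Z) × E) :=
  (ContinuousMap.evalCLM 𝕜 (OnePoint.infty : OnePoint ℕ) ∘L
    ContinuousLinearMap.fst 𝕜 C(OnePoint ℕ, Z) E -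
    J.toContinuousLinearMap ∘L ContinuousLinearMap.snd 𝕜 C(OnePoint ℕ, Z) E).ker

lemma mem_limitSubmodule {J : E →ₗᵢ[𝕜] Z} {x : C(OnePoint ℕ, Z) × E} :
    x ∈ limitSubmodule J ↔ x.1 OnePoint.infty = J x.2 := by
  rw [limitSubmodule, LinearMap.mem_ker]
  exact sub_eq_zero

/-- The space of convergent sequences in `Z` with limit in the image of `E` under the isometry `J`,
with the supremum norm. The element of `E` that represents the limit has at most the norm of the
sequence, so that the maximum norm of the pair is that of the sequence. -/
def LimitSpace (J : E →ₗᵢ[𝕜] Z) : Type _ := limitSubmodule J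

noncomputable instance (J : E →ₗᵢ[𝕜] Z) : NormedAddCommGroup (LimitSpace J) :=
  inferInstanceAs (NormedAddCommGroup (limitSubmodule J))

noncomputable instance (J : E →ₗᵢ[𝕜] Z) : NormedSpace 𝕜 (LimitSpace J) :=
  inferInstanceAs (NormedSpace 𝕜 (limitSubmodule J))

instance (J : E →ₗᵢ[𝕜] Z) [CompleteSpace Z] [CompleteSpace E] : CompleteSpace (LimitSpace J) :=
  have h : IsClosed (limitSubmodule J : Set (C(OnePoint ℕ, Z) × E)) :=
    ContinuousLinearMap.isClosed_ker _
  h.isComplete.completeSpace_coe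

namespace LimitSpace

variable (J : E →ₗᵢ[𝕜] Z)

/-- The `n`-th term of a sequence. -/
noncomputable def term (n : ℕ) : LimitSpace J →L[𝕜] Z :=
  (ContinuousMap.evalCLM 𝕜 (n : OnePoint ℕ) ∘L ContinuousLinearMap.fst 𝕜 C(OnePoint ℕ, Z) E) ∘L
    (limitSubmodule J).subtypeL

/-- The limit of a sequence, as an element of `E`. -/
noncomputable def lim : LimitSpace J →L[𝕜] E :=
  ContinuousLinearMap.snd 𝕜 C(OnePoint ℕ, Z) E ∘L (limitSubmodule J).subtypeL

variable {J}

lemma tendsto_term (x : LimitSpace J) :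
    Tendsto (fun n => term J n x) atTop (𝓝 (J (lim J x))) := by
  have h : J (lim J x) = x.1.1 OnePoint.infty := (mem_limitSubmodule.mp x.2).symm
  rw [h]
  refine (x.1.1.continuous.tendsto OnePoint.infty).comp ?_
  have h := OnePoint.tendsto_coe_infty (X := ℕ)
  rwa [coclosedCompact_eq_cocompact, cocompact_eq_cofinite, Nat.cofinite_eq_atTop] at h

lemma norm_le {x : LimitSpace J} {r : ℝ} (h : ∀ n, ‖term J n x‖ ≤ r) : ‖x‖ ≤ r := by
  have h1 : ‖J (lim J x)‖ ≤ r := le_of_tendsto' (tendsto_term x).norm h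
  have h2 : ‖x.1.2‖ ≤ r := (J.norm_map (lim J x)).symm.le.trans h1
  refine max_le ?_ h2
  refine (ContinuousMap.norm_le _ ((norm_nonneg _).trans h1)).mpr fun p => ?_
  induction p using OnePoint.rec with
  | infty => exact (congrArg norm (mem_limitSubmodule.mp x.2)).le.trans h1
  | coe n => exact h n

lemma norm_term_le (n : ℕ) (x : LimitSpace J) : ‖term J n x‖ ≤ ‖x‖ :=
  (x.1.1.norm_coe_le_norm _).trans (le_max_left _ _)

lemma norm_lim_le (x : LimitSpace J) : ‖lim J x‖ ≤ ‖x‖ := le_max_right _ _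

lemma ext {x y : LimitSpace J} (h : ∀ n, term J n x = term J n y) : x = y := by
  rw [← sub_eq_zero, ← norm_le_zero_iff]
  refine norm_le fun n => ?_
  rw [map_sub, h, sub_self, norm_zero]

variable (J)

/-- The element of `LimitSpace J` given by a sequence with a prescribed limit. -/
noncomputable def mk (s : ℕ → Z) (e : E) (h : Tendsto s atTop (𝓝 (J e))) : LimitSpace J :=
  ⟨(OnePoint.continuousMapMkNat s (J e) h, e), mem_limitSubmodule.mpr rfl⟩

variable {J}

lemma term_mk (s : ℕ → Z) (e : E) (h : Tendsto s atTop (𝓝 (J e))) (n : ℕ) :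
    term J n (mk J s e h) = s n := rfl

lemma tendsto_ite_lt (n : ℕ) (z : Z) :
    Tendsto (fun k => if k < n then 0 else z) atTop (𝓝 z) := by
  refine tendsto_const_nhds.congr' ?_
  filter_upwards [eventually_ge_atTop n] with k hk using (if_neg hk.not_gt).symm

variable (J)

/-- The sequence that vanishes before `n` and is constantly equal to `e` from `n` on. -/
noncomputable def tail (n : ℕ) : E →ₗ[𝕜] LimitSpace J where
  toFun e := mk J (fun k => if k < n then 0 else J e) e (tendsto_ite_lt n (J e))
  map_add' e e' := by
    refine ext fun k => ?_
    rw [map_add (term J k), term_mk, term_mk, term_mk]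
    split_ifs <;> simp
  map_smul' c e := by
    refine ext fun k => ?_
    rw [map_smul (term J k), term_mk, term_mk]
    split_ifs <;> simp

lemma term_tail (n : ℕ) (e : E) (k : ℕ) :
    term J k (tail J n e) = if k < n then 0 else J e := rfl

theorem isAsymptoticLifting : IsAsymptoticLifting (lim J) (tail J) where
  norm_quotient_le := norm_lim_le
  norm_lift_le n e := by
    refine norm_le fun k => ?_
    rw [term_tail]
    split_ifs
    · simp
    · rw [J.norm_map]
  quotient_lift n e := rfl
  eventually_norm_add_le x e ε hε := by
    obtain ⟨N, hN⟩ := Metric.tendsto_atTop.mp (tendsto_term x) ε hε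
    filter_upwards [eventually_ge_atTop N] with n hn
    refine norm_le fun k => ?_
    rw [map_add, term_tail]
    split_ifs with hk
    · rw [add_zero]
      exact ((norm_term_le k x).trans (le_max_left _ _)).trans (le_add_of_nonneg_right hε.le)
    · have h2 := hN k (hn.trans (not_lt.mp hk))
      rw [dist_eq_norm] at h2
      have h3 : term J k x + J e = J (lim J x + e) + (term J k x - J (lim J x)) := by
        rw [map_add]
        abel
      rw [h3]
      refine (norm_add_le _ _).trans (add_le_add ?_ h2.le)
      rw [J.norm_map]
      exact le_max_right _ _

lemma tendsto_ite_eq (n : ℕ) (z : Z) :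
    Tendsto (fun k => if k = n then z else 0) atTop (𝓝 (J 0)) := by
  rw [map_zero]
  refine tendsto_const_nhds.congr' ?_
  filter_upwards [eventually_gt_atTop n] with k hk using (if_neg hk.ne').symm

/-- The coordinates of the terms of a sequence are coordinates of the sequence: every term can be
changed individually without affecting the limit. -/
theorem isCoordinateSystem {ι : Type*} {δ : ι → StrongDual 𝕜 Z} {b : ι → Z}
    (h : IsCoordinateSystem δ b) :
    IsCoordinateSystem (fun i : ℕ × ι => δ i.2 ∘L term J i.1)
      (fun i => mk J (fun k => if k = i.1 then b i.2 else 0) 0 (tendsto_ite_eq J i.1 (b i.2))) where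
  norm_apply_le i x := (h.norm_apply_le _ _).trans (norm_term_le _ x)
  norm_le x r hr hx := norm_le fun n => h.norm_le _ _ hr fun i => hx (n, i)
  apply_self i := by
    rw [ContinuousLinearMap.comp_apply, term_mk, if_pos rfl, h.apply_self]
  apply_of_ne i j hij := by
    rw [ContinuousLinearMap.comp_apply, term_mk]
    split_ifs with h1
    · exact h.apply_of_ne _ _ fun h2 => hij (Prod.ext h1 h2)
    · exact map_zero _

instance [Nontrivial E] : Nontrivial (LimitSpace J) := by
  obtain ⟨e, he⟩ := exists_ne (0 : E)
  refine ⟨⟨tail J 0 e, 0, fun h => he ?_⟩⟩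
  rw [← (isAsymptoticLifting J).quotient_lift 0 e, h, map_zero]

/-- Both spaces of operators contain all maps that factor through the finite-dimensional `E`, as is
needed for the action of `A` to preserve them. -/
theorem numericalIndex_operators_le [FiniteDimensional 𝕜 E] {A : E →L[𝕜] E} (hA : ‖A‖ = 1)
    {v C : ℝ} (hv : 0 ≤ v) (hC : 0 ≤ C)
    (hAv : ∀ (c : 𝕜) (e : E), ‖c‖ ≤ 1 → ‖e + c • A e‖ ≤ (1 + v * ‖c‖ + C * ‖c‖ ^ 2) * ‖e‖)
    (Y : Type*) [NormedAddCommGroup Y] [NormedSpace 𝕜 Y] [Nontrivial Y] :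
    numericalIndex 𝕜 (compactOperator (RingHom.id 𝕜) (LimitSpace J) Y) ≤ v ∧
      numericalIndex 𝕜 (weaklyCompactOperator 𝕜 (LimitSpace J) Y) ≤ v :=
  ⟨(isAsymptoticLifting J).numericalIndex_le hA hv hC hAv
      compactOperator_le_weaklyCompactOperator fun B => comp_mem_compactOperator B _,
    (isAsymptoticLifting J).numericalIndex_le hA hv hC hAv le_rfl fun B =>
      compactOperator_le_weaklyCompactOperator (comp_mem_compactOperator B _)⟩

end LimitSpace

end LimitSpace

theorem numericalIndex_limitSpace_lp {𝕜 : Type*} [RCLike 𝕜] {E Γ : Type*} [NormedAddCommGroup E]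
    [NormedSpace 𝕜 E] [Nontrivial E] (J : E →ₗᵢ[𝕜] lp (fun _ : Γ => 𝕜) ∞) :
    numericalIndex 𝕜 (LimitSpace J) = 1 := by
  classical
  exact (LimitSpace.isCoordinateSystem J (isCoordinateSystem_lp_infty 𝕜 Γ)).numericalIndex_eq_one

/-! ### A complex plane of numerical index `1 / e` -/

section GlickfeldPlane

/-- The plane `ℂ²` with the norm `(a, b) ↦ sup {(‖a‖ + t * ‖b‖) * exp (-t) : 0 ≤ t}`. -/
def GlickfeldPlane : Type := ℂ × ℂ

namespace GlickfeldPlane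

instance : AddCommGroup GlickfeldPlane := inferInstanceAs (AddCommGroup (ℂ × ℂ))

instance : Module ℂ GlickfeldPlane := inferInstanceAs (Module ℂ (ℂ × ℂ))

instance : FiniteDimensional ℂ GlickfeldPlane := inferInstanceAs (FiniteDimensional ℂ (ℂ × ℂ))

instance : Nontrivial GlickfeldPlane := inferInstanceAs (Nontrivial (ℂ × ℂ))

noncomputable instance : Norm GlickfeldPlane :=
  ⟨fun p => ⨆ t : {t : ℝ // 0 ≤ t}, (‖p.1‖ + t * ‖p.2‖) * Real.exp (-t)⟩

lemma bddAbove_range (p : GlickfeldPlane) :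
    BddAbove (range fun t : {t : ℝ // 0 ≤ t} => (‖p.1‖ + t * ‖p.2‖) * Real.exp (-t)) := by
  refine ⟨‖p.1‖ + ‖p.2‖, ?_⟩
  rintro _ ⟨⟨t, ht⟩, rfl⟩
  have h1 : t + 1 ≤ Real.exp t := Real.add_one_le_exp t
  change (‖p.1‖ + t * ‖p.2‖) * Real.exp (-t) ≤ ‖p.1‖ + ‖p.2‖
  rw [Real.exp_neg, ← div_eq_mul_inv, div_le_iff₀ (Real.exp_pos t)]
  nlinarith [norm_nonneg p.1, norm_nonneg p.2]

lemma le_norm (p : GlickfeldPlane) {t : ℝ} (ht : 0 ≤ t) :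
    (‖p.1‖ + t * ‖p.2‖) * Real.exp (-t) ≤ ‖p‖ :=
  le_ciSup (bddAbove_range p) ⟨t, ht⟩

lemma norm_le {p : GlickfeldPlane} {r : ℝ}
    (h : ∀ t : ℝ, 0 ≤ t → (‖p.1‖ + t * ‖p.2‖) * Real.exp (-t) ≤ r) : ‖p‖ ≤ r :=
  have : Nonempty {t : ℝ // 0 ≤ t} := ⟨⟨0, le_rfl⟩⟩
  ciSup_le fun t => h t t.2

lemma norm_fst_le (p : GlickfeldPlane) : ‖p.1‖ ≤ ‖p‖ := by
  simpa using le_norm p le_rfl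

lemma norm_snd_le (p : GlickfeldPlane) : ‖p.2‖ / Real.exp 1 ≤ ‖p‖ := by
  refine le_trans ?_ (le_norm p zero_le_one)
  rw [Real.exp_neg, ← div_eq_mul_inv, one_mul]
  gcongr
  exact le_add_of_nonneg_left (norm_nonneg _)

lemma norm_smul_le' (c : ℂ) (p : GlickfeldPlane) : ‖c • p‖ ≤ ‖c‖ * ‖p‖ := by
  refine norm_le fun t ht => ?_
  have h1 : ‖(c • p).1‖ = ‖c‖ * ‖p.1‖ := norm_mul c p.1
  have h2 : ‖(c • p).2‖ = ‖c‖ * ‖p.2‖ := norm_mul c p.2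
  rw [h1, h2]
  calc _ = ‖c‖ * ((‖p.1‖ + t * ‖p.2‖) * Real.exp (-t)) := by ring
    _ ≤ ‖c‖ * ‖p‖ := by gcongr; exact le_norm p ht

lemma normedSpaceCore : NormedSpace.Core ℂ GlickfeldPlane where
  norm_nonneg p := (norm_nonneg p.1).trans (norm_fst_le p)
  norm_smul c p := by
    refine le_antisymm (norm_smul_le' c p) ?_
    rcases eq_or_ne c 0 with rfl | hc
    · rw [norm_zero, zero_mul]
      exact (norm_nonneg _).trans (norm_fst_le _)
    · have h := norm_smul_le' c⁻¹ (c • p)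
      rwa [inv_smul_smul₀ hc, norm_inv, ← div_eq_inv_mul, le_div_iff₀ (norm_pos_iff.mpr hc),
        mul_comm] at h
  norm_triangle p p' := by
    refine norm_le fun t ht => ?_
    have h1 : ‖(p + p').1‖ ≤ ‖p.1‖ + ‖p'.1‖ := norm_add_le p.1 p'.1
    have h2 : ‖(p + p').2‖ ≤ ‖p.2‖ + ‖p'.2‖ := norm_add_le p.2 p'.2
    calc _ ≤ ((‖p.1‖ + ‖p'.1‖) + t * (‖p.2‖ + ‖p'.2‖)) * Real.exp (-t) := by gcongr
      _ = (‖p.1‖ + t * ‖p.2‖) * Real.exp (-t) + (‖p'.1‖ + t * ‖p'.2‖) * Real.exp (-t) := by ring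
      _ ≤ ‖p‖ + ‖p'‖ := add_le_add (le_norm p ht) (le_norm p' ht)
  norm_eq_zero_iff p := by
    constructor
    · intro h
      have h1 := norm_fst_le p
      have h2 := norm_snd_le p
      rw [h] at h1 h2
      rw [div_le_iff₀ (Real.exp_pos 1), zero_mul] at h2
      exact Prod.ext (norm_le_zero_iff.mp h1) (norm_le_zero_iff.mp h2)
    · rintro rfl
      refine le_antisymm (norm_le fun t ht => ?_) ((norm_nonneg _).trans (norm_fst_le 0))
      have h1 : (0 : GlickfeldPlane).1 = 0 := rfl
      have h2 : (0 : GlickfeldPlane).2 = 0 := rfl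
      simp [h1, h2]

noncomputable instance : NormedAddCommGroup GlickfeldPlane :=
  NormedAddCommGroup.ofCore normedSpaceCore

noncomputable instance : NormedSpace ℂ GlickfeldPlane := NormedSpace.ofCore normedSpaceCore

/-- The shift `(a, b) ↦ (b / e, 0)`. -/
noncomputable def shift : GlickfeldPlane →L[ℂ] GlickfeldPlane :=
  LinearMap.mkContinuous
    { toFun := fun p => ((Real.exp 1 : ℂ)⁻¹ * p.2, 0)
      map_add' := fun p p' => Prod.ext (mul_add _ p.2 p'.2) (add_zero _).symm
      map_smul' := fun c p => Prod.ext (mul_left_comm _ c p.2) (mul_zero c).symm } 1 fun p => by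
    rw [one_mul]
    refine norm_le fun t ht => ?_
    have h1 : Real.exp (-t) ≤ 1 := Real.exp_le_one_iff.mpr (neg_nonpos.mpr ht)
    calc (‖(Real.exp 1 : ℂ)⁻¹ * p.2‖ + t * ‖(0 : ℂ)‖) * Real.exp (-t)
        = ‖p.2‖ / Real.exp 1 * Real.exp (-t) := by
          rw [norm_mul, norm_inv, Complex.norm_real, Real.norm_of_nonneg (Real.exp_pos 1).le,
            norm_zero]
          ring
      _ ≤ ‖p.2‖ / Real.exp 1 := mul_le_of_le_one_right (by positivity) h1
      _ ≤ ‖p‖ := norm_snd_le p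

lemma norm_shift : ‖shift‖ = 1 := by
  refine le_antisymm (LinearMap.mkContinuous_norm_le _ zero_le_one _) ?_
  -- The supremum of `t * exp (-t)` is `1 / e`, so that the norm is attained at `(0, 1)`.
  let p : GlickfeldPlane := (0, 1)
  have hp : ‖p‖ ≤ (Real.exp 1)⁻¹ := by
    refine norm_le fun t ht => ?_
    change (‖(0 : ℂ)‖ + t * ‖(1 : ℂ)‖) * Real.exp (-t) ≤ _
    rw [norm_zero, norm_one, zero_add, mul_one, ← Real.exp_neg]
    have h1 : t ≤ Real.exp (t - 1) := by simpa using Real.add_one_le_exp (t - 1)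
    calc t * Real.exp (-t) ≤ Real.exp (t - 1) * Real.exp (-t) := by gcongr
      _ = Real.exp (-1) := by rw [← Real.exp_add]; congr 1; ring
  have h1 : (Real.exp 1)⁻¹ ≤ ‖shift p‖ := by
    have h2 := norm_fst_le (shift p)
    have h3 : (shift p).1 = (Real.exp 1 : ℂ)⁻¹ * 1 := rfl
    rwa [h3, mul_one, norm_inv, Complex.norm_real, Real.norm_of_nonneg (Real.exp_pos 1).le] at h2
  have h4 : (Real.exp 1)⁻¹ ≤ ‖shift‖ * (Real.exp 1)⁻¹ :=
    h1.trans ((shift.le_opNorm p).trans (by gcongr))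
  exact (le_mul_iff_one_le_left (inv_pos.mpr (Real.exp_pos 1))).mp h4

/-- The norm is chosen so that the group `exp (c • shift) = 1 + c • shift` grows at most as
`exp (‖c‖ / e)`: a translation of `t` by `‖c‖ / e` in the supremum absorbs the shift. -/
lemma norm_add_smul_shift_le (c : ℂ) (p : GlickfeldPlane) :
    ‖p + c • shift p‖ ≤ Real.exp (‖c‖ / Real.exp 1) * ‖p‖ := by
  set s := ‖c‖ / Real.exp 1 with hs
  have hs0 : 0 ≤ s := by positivity
  refine norm_le fun t ht => ?_
  have h1 : ‖(p + c • shift p).1‖ ≤ ‖p.1‖ + s * ‖p.2‖ := by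
    have h3 : (p + c • shift p).1 = p.1 + c * ((Real.exp 1 : ℂ)⁻¹ * p.2) := rfl
    rw [h3]
    refine (norm_add_le _ _).trans_eq ?_
    rw [norm_mul, norm_mul, norm_inv, Complex.norm_real, Real.norm_of_nonneg (Real.exp_pos 1).le,
      hs]
    ring
  have h2 : (p + c • shift p).2 = p.2 := by
    have h3 : (p + c • shift p).2 = p.2 + c * 0 := rfl
    rw [h3, mul_zero, add_zero]
  rw [h2]
  calc _ ≤ (‖p.1‖ + s * ‖p.2‖ + t * ‖p.2‖) * Real.exp (-t) := by gcongr
    _ = Real.exp s * ((‖p.1‖ + (s + t) * ‖p.2‖) * Real.exp (-(s + t))) := by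
        rw [neg_add, Real.exp_add, Real.exp_neg s]
        have := (Real.exp_pos s).ne'
        field_simp
        ring
    _ ≤ Real.exp s * ‖p‖ := by gcongr; exact le_norm p (by positivity)

lemma norm_add_smul_shift_le_quadratic (c : ℂ) (p : GlickfeldPlane) (hc : ‖c‖ ≤ 1) :
    ‖p + c • shift p‖ ≤ (1 + 1 / Real.exp 1 * ‖c‖ + (1 / Real.exp 1) ^ 2 * ‖c‖ ^ 2) * ‖p‖ := by
  refine (norm_add_smul_shift_le c p).trans (mul_le_mul_of_nonneg_right ?_ (norm_nonneg p))
  have he : 1 ≤ Real.exp 1 := Real.one_le_exp zero_le_one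
  have h1 : |‖c‖ / Real.exp 1| ≤ 1 := by
    rw [abs_of_nonneg (by positivity), div_le_one (Real.exp_pos 1)]
    exact hc.trans he
  have h2 := (abs_le.mp (Real.abs_exp_sub_one_sub_id_le h1)).2
  calc _ ≤ 1 + ‖c‖ / Real.exp 1 + (‖c‖ / Real.exp 1) ^ 2 := by linarith
    _ = _ := by ring

end GlickfeldPlane

end GlickfeldPlane

/-! ### The real and the complex example -/

lemma norm_mul_I_eq_one : ‖ContinuousLinearMap.mul ℝ ℂ Complex.I‖ = 1 := by
  rw [ContinuousLinearMap.opNorm_mul_apply, Complex.norm_I]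

/-- The rotation of the plane by a right angle has numerical radius zero. -/
lemma norm_add_smul_mul_I_le (c : ℝ) (z : ℂ) :
    ‖z + c • ContinuousLinearMap.mul ℝ ℂ Complex.I z‖ ≤ (1 + 0 * ‖c‖ + 1 * ‖c‖ ^ 2) * ‖z‖ := by
  have h1 : z + c • ContinuousLinearMap.mul ℝ ℂ Complex.I z = (1 + c * Complex.I) * z := by
    rw [ContinuousLinearMap.mul_apply', Complex.real_smul]
    ring
  rw [h1, norm_mul]
  refine mul_le_mul_of_nonneg_right ?_ (norm_nonneg z)
  have h2 : ‖(1 : ℂ) + c * Complex.I‖ = Real.sqrt (1 ^ 2 + c ^ 2) := by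
    simpa using Complex.norm_add_mul_I 1 c
  rw [h2, Real.norm_eq_abs, sq_abs]
  refine Real.sqrt_le_iff.mpr ⟨by positivity, ?_⟩
  nlinarith [sq_nonneg c, sq_nonneg (c ^ 2)]

theorem one_div_exp_one_le_numericalIndex_of_compactOperator_le {X Y : Type*}
    [NormedAddCommGroup X] [NormedSpace ℂ X] [Nontrivial X] [NormedAddCommGroup Y]
    [NormedSpace ℂ Y] [Nontrivial Y] {M : Submodule ℂ (X →L[ℂ] Y)}
    (hM : compactOperator (RingHom.id ℂ) X Y ≤ M) : 1 / Real.exp 1 ≤ numericalIndex ℂ M :=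
  have := nontrivial_of_contains_compactOperator hM
  le_numericalIndex fun _ hT => one_div_exp_one_le_numericalRadius hT

theorem mainTheorem7 :
    (∃ (X : Type) (_ : NormedAddCommGroup X) (_ : NormedSpace ℝ X) (_ : CompleteSpace X),
      numericalIndex ℝ X = 1 ∧
      (∀ (Y : Type u) [NormedAddCommGroup Y] [NormedSpace ℝ Y] [CompleteSpace Y] [Nontrivial Y],
        numericalIndex ℝ (compactOperator (RingHom.id ℝ) X Y) = 0 ∧
        numericalIndex ℝ (weaklyCompactOperator ℝ X Y) = 0) ∧
      numericalIndex ℝ (compactOperator (RingHom.id ℝ) X X) = 0 ∧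
      numericalIndex ℝ (weaklyCompactOperator ℝ X X) = 0) ∧
    (∃ (X : Type) (_ : NormedAddCommGroup X) (_ : NormedSpace ℂ X) (_ : CompleteSpace X),
      numericalIndex ℂ X = 1 ∧
      (∀ (Y : Type u) [NormedAddCommGroup Y] [NormedSpace ℂ Y] [CompleteSpace Y] [Nontrivial Y],
        numericalIndex ℂ (compactOperator (RingHom.id ℂ) X Y) = 1 / Real.exp 1 ∧
        numericalIndex ℂ (weaklyCompactOperator ℂ X Y) = 1 / Real.exp 1) ∧
      numericalIndex ℂ (compactOperator (RingHom.id ℂ) X X) = 1 / Real.exp 1 ∧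
      numericalIndex ℂ (weaklyCompactOperator ℂ X X) = 1 / Real.exp 1) := by
  constructor
  · obtain ⟨J⟩ := exists_linearIsometry_lp_infty ℝ ℂ
    have h := LimitSpace.numericalIndex_operators_le J norm_mul_I_eq_one le_rfl zero_le_one
      fun c z _ => norm_add_smul_mul_I_le c z
    have h' := LimitSpace.numericalIndex_operators_le J norm_mul_I_eq_one le_rfl zero_le_one
      (fun c z _ => norm_add_smul_mul_I_le c z) (LimitSpace J)
    exact ⟨LimitSpace J, inferInstance, inferInstance, inferInstance,
      numericalIndex_limitSpace_lp J,
      fun Y _ _ _ _ => ⟨le_antisymm (h Y).1 numericalIndex_nonneg,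
        le_antisymm (h Y).2 numericalIndex_nonneg⟩,
      le_antisymm h'.1 numericalIndex_nonneg, le_antisymm h'.2 numericalIndex_nonneg⟩
  · obtain ⟨J⟩ := exists_linearIsometry_lp_infty ℂ GlickfeldPlane
    have : CompleteSpace GlickfeldPlane := FiniteDimensional.complete ℂ GlickfeldPlane
    have he : 0 ≤ 1 / Real.exp 1 := by positivity
    have h := LimitSpace.numericalIndex_operators_le J GlickfeldPlane.norm_shift he (sq_nonneg _)
      GlickfeldPlane.norm_add_smul_shift_le_quadratic
    have h' := LimitSpace.numericalIndex_operators_le J GlickfeldPlane.norm_shift he (sq_nonneg _)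
      GlickfeldPlane.norm_add_smul_shift_le_quadratic (LimitSpace J)
    exact ⟨LimitSpace J, inferInstance, inferInstance, inferInstance,
      numericalIndex_limitSpace_lp J,
      fun Y _ _ _ _ =>
        ⟨le_antisymm (h Y).1 (one_div_exp_one_le_numericalIndex_of_compactOperator_le le_rfl),
          le_antisymm (h Y).2 (one_div_exp_one_le_numericalIndex_of_compactOperator_le
            compactOperator_le_weaklyCompactOperator)⟩,
      le_antisymm h'.1 (one_div_exp_one_le_numericalIndex_of_compactOperator_le le_rfl),
      le_antisymm h'.2 (one_div_exp_one_le_numericalIndex_of_compactOperator_le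
        compactOperator_le_weaklyCompactOperator)⟩
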